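/- Let $\mathbb K=\mathbb R$ or $\mathbb C$ and let $\mathfrak g$ be a finite-dimensional Lie algebra over $\mathbb K$. An \emph{ad-invariant metric} on $\mathfrak g$ is a nondegenerate symmetric $\mathbb K$-bilinear form $g$ with $g([X,Y],Z)=-g(Y,[X,Z])$ for all $X,Y,Z\in\mathfrak g$. Such a $g$ is \emph{solitary} if every $g$-self-adjoint linear map $\phi\colon\mathfrak g\to\mathfrak g$ satisfying $\phi([X,Y])=[X,\phi(Y)]$ for all $X,Y$ has the form $\phi=D+D^{*}$, where $D$ is a derivation of $\mathfrak g$ and $D^{*}$ is its $g$-adjoint; $\mathfrak g$ is \emph{solitary} if it admits a solitary ad-invariant metric. Let $\mathfrak g$ act on $\mathfrak g^*$ by $[X,\alpha]=-\alpha\circ\mathrm{ad}_X$. The Lie algebra $\mathfrak g$ is \emph{$T^*$-solitary} if for every linear map $\phi\colon\mathfrak g\to\mathfrak g^*$ with $\phi(X)(Y)=\phi(Y)(X)$ and $\phi([X,Y])=[X,\phi(Y)]$ for all $X,Y$, there is a linear map $D\colon\mathfrak g\to\mathfrak g^*$ with $D([X,Y])=[X,D(Y)]-[Y,D(X)]$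 for all $X,Y$ such that $\phi(X)(Y)=D(X)(Y)+D(Y)(X)$ for all $X,Y$. Theorem. (1) If $\mathfrak g$ is $T^*$-solitary, then $\mathfrak g$ is solvable. (2) If $\mathfrak g$ is solitary, then $\mathfrak g$ is solvable. (3) If $\mathfrak g$ admits an ad-invariant metric that is unique up to automorphisms and sign, i.e. there is an ad-invariant metric $g$ such that every ad-invariant metric on $\mathfrak g$ has the form $\pm g(\psi\,\cdot,\psi\,\cdot)$ with $\psi\in\mathrm{Aut}(\mathfrak g)$, then $\mathfrak g$ is solvable. (4) More generally, suppose that $\mathfrak g$ has an ad-invariant metric $g$ and a decomposition $\mathfrak g=\mathfrak g_1\oplus\dots\oplus\mathfrak g_n$ into pairwise $g$-orthogonal ideals, with $g=g_1+\dots+g_n$ accordingly, such that every ad-invariant metric on $\mathfrak g$ has the form $h(\psi\,\cdot,\psi\,\cdot)$ with $\psi\in\mathrm{Aut}(\mathfrak g)$ and $h=\pm g_1\pm\dots\pm g_n$. Then $\mathfrak g$ is solvable. -/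

import Mathlib

/-- An ad-invariant metric on a Lie algebra: a symmetric nondegenerate bilinear form `g` with
`g ⁅x, y⁆ z = - g y ⁅x, z⁆`. -/
structure IsAdInvariantMetric {K L : Type*} [Field K] [LieRing L] [LieAlgebra K L]
    (g : LinearMap.BilinForm K L) : Prop where
  symm : g.IsSymm
  nondegenerate : g.Nondegenerate
  invariant : g.lieInvariant L

/-- A metric `g` is solitary if every ad-invariant (`φ ⁅x, y⁆ = ⁅x, φ y⁆`) and `g`-self-adjoint
endomorphism `φ` has the form `D + D'`, with `D` a derivation and `D'` the `g`-adjoint of `D`. -/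
def IsSolitaryMetric {K L : Type*} [Field K] [LieRing L] [LieAlgebra K L]
    (g : LinearMap.BilinForm K L) : Prop :=
  ∀ φ : L →ₗ[K] L, (∀ x y : L, φ ⁅x, y⁆ = ⁅x, φ y⁆) → g.IsSelfAdjoint φ →
    ∃ (D : LieDerivation K L L) (D' : L →ₗ[K] L),
      LinearMap.IsAdjointPair g g D D' ∧ φ = D.toLinearMap + D'

/-- A solitary Lie algebra: it admits a solitary ad-invariant metric. -/
def IsSolitary (K L : Type*) [Field K] [LieRing L] [LieAlgebra K L] : Prop :=
  ∃ g : LinearMap.BilinForm K L, IsAdInvariantMetric g ∧ IsSolitaryMetric g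

/-- A `T^*`-solitary Lie algebra: every ad-invariant (`φ ⁅x, y⁆ = ⁅x, φ y⁆`) and symmetric linear
map `φ : L → L^*` has the form `D + Dᵗ` with `D : L → L^*` a derivation.  Here `L^*` carries the
coadjoint action `⁅x, α⁆ = -α ∘ ad x`, and `D` is a derivation if
`D ⁅x, y⁆ = ⁅x, D y⁆ - ⁅y, D x⁆`; for linear maps `L → L^*` these two conditions say precisely
that the extension by zero to `L ⋉ L^*` is ad-invariant, respectively a derivation. -/
def IsCotangentSolitary (K L : Type*) [Field K] [LieRing L] [LieAlgebra K L] : Prop :=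
  ∀ φ : L →ₗ[K] Module.Dual K L, (∀ x y : L, φ ⁅x, y⁆ = ⁅x, φ y⁆) →
    (∀ x y : L, φ x y = φ y x) →
    ∃ D : LieDerivation K L (Module.Dual K L), ∀ x y : L, φ x y = D x y + D y x

/-- There is exactly one ad-invariant metric up to automorphisms and sign. -/
def HasUniqueMetricUpToSign (K L : Type*) [Field K] [LieRing L] [LieAlgebra K L] : Prop :=
  ∃ g : LinearMap.BilinForm K L, IsAdInvariantMetric g ∧
    ∀ h : LinearMap.BilinForm K L, IsAdInvariantMetric h →
      ∃ (ψ : L ≃ₗ⁅K⁆ L) (ε : K), (ε = 1 ∨ ε = -1) ∧ ∀ x y : L, h x y = ε * g (ψ x) (ψ y)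

/-- `L` is the direct sum of the ideals `I i`, which are pairwise orthogonal for `g`. -/
structure IsOrthogonalDecomposition {K L : Type*} [Field K] [LieRing L] [LieAlgebra K L]
    (g : LinearMap.BilinForm K L) {n : ℕ} (I : Fin n → LieIdeal K L) : Prop where
  internal : DirectSum.IsInternal fun i => (I i).toSubmodule
  orthogonal : ∀ i j, i ≠ j → ∀ x ∈ I i, ∀ y ∈ I j, g x y = 0

/-- There is exactly one ad-invariant metric up to automorphisms and up to independent changes of
sign on the summands of an orthogonal decomposition into ideals: for some ad-invariant metric
`g = g₁ + ⋯ + gₙ`, each ad-invariant metric is `h(ψ ·, ψ ·)` with `ψ` an automorphism and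
`h = ± g₁ ± ⋯ ± gₙ`. -/
def HasUniqueMetricUpToSigns (K L : Type*) [Field K] [LieRing L] [LieAlgebra K L] : Prop :=
  ∃ (g : LinearMap.BilinForm K L) (n : ℕ) (I : Fin n → LieIdeal K L),
    IsAdInvariantMetric g ∧ IsOrthogonalDecomposition g I ∧
    ∀ g' : LinearMap.BilinForm K L, IsAdInvariantMetric g' →
      ∃ (ψ : L ≃ₗ⁅K⁆ L) (ε : Fin n → K) (h : LinearMap.BilinForm K L),
        (∀ i, ε i = 1 ∨ ε i = -1) ∧ IsOrthogonalDecomposition h I ∧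
        (∀ i, ∀ x ∈ I i, ∀ y ∈ I i, h x y = ε i * g x y) ∧
        ∀ x y : L, g' x y = h (ψ x) (ψ y)

lemma exists_last_nonzero_pow {K V : Type*} [Field K] [AddCommGroup V] [Module K V]
    (N : Module.End K V) {x : V} (hx : x ≠ 0) {k : ℕ} (hk : (N ^ k) x = 0) :
    ∃ j, (N ^ j) x ≠ 0 ∧ N ((N ^ j) x) = 0 := by
  obtain ⟨j, hj, hj'⟩ := Nat.exists_not_and_succ_of_not_zero_of_exists
    (p := fun k => (N ^ k) x = 0) (by simpa using hx) ⟨k, hk⟩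
  exact ⟨j, hj, by rwa [← Module.End.mul_apply, ← pow_succ']⟩

lemma exists_eq_add_of_ker_pow {K V : Type*} [Field K] [AddCommGroup V] [Module K V]
    [FiniteDimensional K V] (N : Module.End K V) :
    ∃ k, ∀ r, ∃ r₀ b, (N ^ k) r₀ = 0 ∧ r = r₀ + N b := by
  obtain ⟨k, hk, hk1⟩ := (N.eventually_isCompl_ker_pow_range_pow.and
    (Filter.eventually_ge_atTop 1)).exists
  refine ⟨k, fun r => ?_⟩
  obtain ⟨x, hx, y, ⟨z, rfl⟩, rfl⟩ := Submodule.mem_sup.mp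
    (hk.sup_eq_top ▸ Submodule.mem_top : r ∈ LinearMap.ker (N ^ k) ⊔ LinearMap.range (N ^ k))
  refine ⟨x, (N ^ (k - 1)) z, hx, ?_⟩
  rw [← Module.End.mul_apply, ← pow_succ', Nat.sub_add_cancel hk1]

section Sl2Endomorphisms

attribute [local instance 100] LieRing.ofAssociativeRing

open Module

variable {K V : Type*} [Field K] [CharZero K] [AddCommGroup V] [Module K V]
  [FiniteDimensional K V] {H E F : End K V}

lemma exists_nat_of_primitive_vector (hHE : H * E - E * H = (2 : K) • E)
    (hHF : H * F - F * H = -((2 : K) • F)) (hEF : E * F - F * E = H) {v : V} {μ : K} (hv : v ≠ 0)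
    (hEv : E v = 0) (hHv : H v = μ • v) : ∃ n : ℕ, μ = n := by
  by_cases hH : H = 0
  · refine ⟨0, ?_⟩
    have : μ • v = 0 := by rw [← hHv, hH, LinearMap.zero_apply]
    simpa [hv] using this
  · have t : IsSl2Triple H E F :=
      ⟨hH, hEF, by rw [Ring.lie_def, hHE, two_smul, two_smul],
        by rw [Ring.lie_def, hHF, two_smul, two_smul]⟩
    have P : t.HasPrimitiveVectorWith v μ := ⟨hv, hHv, hEv⟩
    exact P.exists_nat

lemma eq_zero_of_E_eq_zero_of_mem_ker_pow (hHE : H * E - E * H = (2 : K) • E)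
    (hHF : H * F - F * H = -((2 : K) • F)) (hEF : E * F - F * E = H) {x : V} {k : ℕ}
    (hx : ((H + 2) ^ k) x = 0) (hEx : E x = 0) : x = 0 := by
  by_contra hx0
  obtain ⟨j, hj, hj'⟩ := exists_last_nonzero_pow _ hx0 hx
  have hc : SemiconjBy E (H + 2) H := by
    rw [two_smul] at hHE
    unfold SemiconjBy
    have e1 : E * H = H * E - (E + E) := by rw [← hHE]; abel
    calc E * (H + 2) = E * H + (E + E) := by noncomm_ring
      _ = H * E := by rw [e1]; abel
  have hE : E (((H + 2) ^ j) x) = 0 := by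
    rw [← Module.End.mul_apply, (hc.pow_right j).eq, Module.End.mul_apply, hEx, map_zero]
  obtain ⟨n, hn⟩ := exists_nat_of_primitive_vector hHE hHF hEF (μ := -2) hj hE (by
    rw [LinearMap.add_apply, add_eq_zero_iff_eq_neg] at hj'
    rw [hj', neg_smul, two_smul, ← one_add_one_eq_two]
    rfl)
  have : ((n + 2 : ℕ) : K) = 0 := by push_cast; rw [← hn]; ring
  exact absurd this (Nat.cast_ne_zero.mpr (by omega))

lemma eq_zero_of_EF_eq_zero (hHE : H * E - E * H = (2 : K) • E)
    (hEF : E * F - F * E = H) {y : V} (hHy : H y = (2 : K) • y) (hEFy : E (F y) = 0) : y = 0 := by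
  by_contra hy
  have h1 (k : ℕ) : H ((E ^ k) y) = (2 + 2 * k : K) • (E ^ k) y := by
    induction k with
    | zero => simpa using hHy
    | succ k ih =>
      have := LinearMap.congr_fun hHE ((E ^ k) y)
      simp only [LinearMap.sub_apply, Module.End.mul_apply, LinearMap.smul_apply, ih,
        map_smul] at this
      rw [pow_succ', Module.End.mul_apply, sub_eq_iff_eq_add.mp this, ← add_smul]
      push_cast
      ring_nf
  have h2 (k : ℕ) : F ((E ^ (k + 1)) y) = (-((k + 1) * (k + 2)) : K) • (E ^ k) y := by
    have key (k : ℕ) : F ((E ^ (k + 1)) y) = E (F ((E ^ k) y)) - (2 + 2 * k : K) • (E ^ k) y := by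
      have := LinearMap.congr_fun hEF ((E ^ k) y)
      simp only [LinearMap.sub_apply, Module.End.mul_apply, h1] at this
      rw [pow_succ', Module.End.mul_apply, ← this]
      abel
    induction k with
    | zero =>
      rw [key]
      simp [hEFy]
    | succ k ih =>
      rw [key, ih, map_smul, ← Module.End.mul_apply, ← pow_succ', ← sub_smul]
      push_cast
      ring_nf
  have h3 (k : ℕ) : (E ^ k) y ≠ 0 := by
    induction k with
    | zero => simpa using hy
    | succ k ih =>
      intro h0
      have := h2 k
      rw [h0, map_zero, eq_comm, smul_eq_zero] at this
      rcases this with h | h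
      · have : ((((k + 1) * (k + 2) : ℕ)) : K) = 0 := by push_cast; exact neg_eq_zero.mp h
        exact absurd this (Nat.cast_ne_zero.mpr (by positivity))
      · exact ih h
  have hinj : Function.Injective fun k : ℕ => (2 + 2 * k : K) := fun a b hab => by
    simpa using hab
  have hli := Module.End.eigenvectors_linearIndependent' H (fun k : ℕ => (2 + 2 * k : K)) hinj
    (fun k => (E ^ k) y) (fun k => ⟨Module.End.mem_eigenspace_iff.mpr (h1 k), h3 k⟩)
  have := hli.finite_of_isNoetherian
  exact not_finite ℕ

lemma exists_mem_ker_pow_of_mem_ker_pow (hHE : H * E - E * H = (2 : K) • E)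
    (hHF : H * F - F * H = -((2 : K) • F)) (hEF : E * F - F * E = H) {r : V} {k : ℕ}
    (hr : ((H - 2) ^ k) r = 0) : ∃ b, ((H - 2) ^ k) b = 0 ∧ H b - (2 : K) • b + E (F b) = r := by
  set T : End K V := H - 2 + E * F
  have hc : Commute T (H - 2) := by
    rw [two_smul] at hHE hHF
    have : Commute (E * F) (H - 2) := by
      unfold Commute SemiconjBy
      have e1 : E * H = H * E - (E + E) := by rw [← hHE]; abel
      have e2 : F * H = H * F + (F + F) := by rw [← neg_neg (F + F), ← hHF]; abel
      calc E * F * (H - 2) = E * (F * H) - (E * F + E * F) := by noncomm_ring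
        _ = E * H * F + E * F + E * F - (E * F + E * F) := by rw [e2]; noncomm_ring
        _ = (H - 2) * (E * F) := by rw [e1]; noncomm_ring
    exact (Commute.refl _).add_left this
  have hmaps : ∀ x ∈ LinearMap.ker ((H - 2) ^ k), T x ∈ LinearMap.ker ((H - 2) ^ k) := by
    intro x hx
    rw [LinearMap.mem_ker] at hx ⊢
    rw [← Module.End.mul_apply, ← (hc.pow_right k).eq, Module.End.mul_apply, hx, map_zero]
  have hinj : Function.Injective (T.restrict hmaps) := by
    rw [← LinearMap.ker_eq_bot, LinearMap.ker_eq_bot']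
    rintro ⟨x, hx⟩ hTx
    replace hTx : T x = 0 := congrArg Subtype.val hTx
    by_contra hx0
    have hx0' : x ≠ 0 := fun h => hx0 (by simp [h])
    obtain ⟨j, hj, hj'⟩ := exists_last_nonzero_pow _ hx0' (LinearMap.mem_ker.mp hx)
    have hTy : T (((H - 2) ^ j) x) = 0 := by
      rw [← Module.End.mul_apply, (hc.pow_right j).eq, Module.End.mul_apply, hTx, map_zero]
    refine hj (eq_zero_of_EF_eq_zero hHE hEF ?_ ?_)
    · rw [LinearMap.sub_apply, sub_eq_zero] at hj'
      rw [hj', two_smul, ← one_add_one_eq_two]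
      rfl
    · simpa [T, -LinearMap.sub_apply, hj'] using hTy
  obtain ⟨⟨b, hb⟩, hTb⟩ := LinearMap.surjective_of_injective hinj ⟨r, hr⟩
  replace hTb : T b = r := congrArg Subtype.val hTb
  refine ⟨b, hb, ?_⟩
  rw [← hTb, two_smul]
  simp only [T, LinearMap.add_apply, LinearMap.sub_apply, Module.End.mul_apply,
    ← one_add_one_eq_two, Module.End.one_apply]

end Sl2Endomorphisms

section Lifting

open Module LieAlgebra

variable {K L : Type*} [Field K] [LieRing L] [LieAlgebra K L]

theorem LieIdeal.exists_isSl2Triple_of_quotient [CharZero K] [FiniteDimensional K L]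
    (A : LieIdeal K L) [IsLieAbelian A] {h' e' f' : L ⧸ A} (t : IsSl2Triple h' e' f') :
    ∃ h e f : L, IsSl2Triple h e f := by
  obtain ⟨h, rfl⟩ := LieSubmodule.Quotient.surjective_mk' A h'
  obtain ⟨e, rfl⟩ := LieSubmodule.Quotient.surjective_mk' A e'
  obtain ⟨f, rfl⟩ := LieSubmodule.Quotient.surjective_mk' A f'
  have mk_eq (x y : L) (hxy : LieSubmodule.Quotient.mk' A x = LieSubmodule.Quotient.mk' A y) :
      ∃ a : A, x = y + a := by
    have : x - y ∈ A := by
      have h0 := sub_eq_zero.mpr hxy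
      rw [← map_sub] at h0
      exact (LieSubmodule.Quotient.mk_eq_zero' (N := A)).mp h0
    exact ⟨⟨x - y, this⟩, by simp⟩
  have mk_lie (x y : L) : LieSubmodule.Quotient.mk' A ⁅x, y⁆ =
      ⁅LieSubmodule.Quotient.mk' A x, LieSubmodule.Quotient.mk' A y⁆ := rfl
  have mk_a (a : A) : LieSubmodule.Quotient.mk' A (a : L) = 0 :=
    (LieSubmodule.Quotient.mk_eq_zero' (N := A)).mpr a.2
  have hA (a b : A) : ⁅(a : L), (b : L)⁆ = 0 := by
    have := trivial_lie_zero A A a b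
    simpa using congrArg Subtype.val this
  set H : End K A := LieModule.toEnd K L A h
  set E : End K A := LieModule.toEnd K L A e
  set F : End K A := LieModule.toEnd K L A f
  have hH (a : A) : ((H a : A) : L) = ⁅h, (a : L)⁆ := rfl
  have hE (a : A) : ((E a : A) : L) = ⁅e, (a : L)⁆ := rfl
  have hF (a : A) : ((F a : A) : L) = ⁅f, (a : L)⁆ := rfl
  obtain ⟨r, hr⟩ := mk_eq ⁅h, e⁆ ((2 : K) • e) (by
    rw [mk_lie, t.lie_h_e_nsmul, map_smul, two_smul, two_smul])
  obtain ⟨s, hs⟩ := mk_eq ⁅h, f⁆ (-((2 : K) • f)) (by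
    rw [mk_lie, t.lie_h_f_nsmul, map_neg, map_smul, two_smul, two_smul])
  obtain ⟨q, hq⟩ := mk_eq ⁅e, f⁆ h (by rw [mk_lie, t.lie_e_f])
  have hHE : H * E - E * H = (2 : K) • E := by
    ext a
    simp only [LinearMap.sub_apply, Module.End.mul_apply, LinearMap.smul_apply,
      LieSubmodule.coe_sub, LieSubmodule.coe_smul, hH, hE]
    rw [leibniz_lie, hr, add_lie, hA, smul_lie]
    abel
  have hHF : H * F - F * H = -((2 : K) • F) := by
    ext a
    simp only [LinearMap.sub_apply, Module.End.mul_apply, LinearMap.smul_apply, LinearMap.neg_apply,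
      LieSubmodule.coe_sub, LieSubmodule.coe_smul, LieSubmodule.coe_neg, hH, hF]
    rw [leibniz_lie, hs, add_lie, hA, neg_lie, smul_lie]
    abel
  have hEF : E * F - F * E = H := by
    ext a
    simp only [LinearMap.sub_apply, Module.End.mul_apply, LieSubmodule.coe_sub, hH, hE, hF]
    rw [leibniz_lie, hq, add_lie, hA]
    abel
  have two_app (a : A) : (2 : End K A) a = (2 : K) • a := by
    rw [two_smul, ← one_add_one_eq_two]; rfl
  have scE : SemiconjBy E H (H - 2) := by
    rw [two_smul] at hHE
    have e1 : E * H = H * E - (E + E) := by rw [← hHE]; abel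
    unfold SemiconjBy
    rw [e1]; noncomm_ring
  have scE' : SemiconjBy E (H + 2) H := by
    rw [two_smul] at hHE
    have e1 : E * H = H * E - (E + E) := by rw [← hHE]; abel
    unfold SemiconjBy
    rw [mul_add, e1]; noncomm_ring
  have scF : SemiconjBy F H (H + 2) := by
    rw [two_smul] at hHF
    have e1 : F * H = H * F + (F + F) := by rw [← neg_neg (F + F), ← hHF]; abel
    unfold SemiconjBy
    rw [e1]; noncomm_ring
  have scF' : SemiconjBy F (H - 2) H := by
    rw [two_smul] at hHF
    have e1 : F * H = H * F + (F + F) := by rw [← neg_neg (F + F), ← hHF]; abel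
    unfold SemiconjBy
    rw [mul_sub, e1]; noncomm_ring
  have ker_map {N N' T : End K A} (hT : SemiconjBy T N N') {k : ℕ} {a : A} (ha : (N ^ k) a = 0) :
      (N' ^ k) (T a) = 0 := by
    rw [← Module.End.mul_apply, ← (hT.pow_right k).eq, Module.End.mul_apply, ha, map_zero]
  have ker_le (N : End K A) {k l : ℕ} (hkl : k ≤ l) {a : A} (ha : (N ^ k) a = 0) :
      (N ^ l) a = 0 := by
    rw [← Nat.sub_add_cancel hkl, pow_add, Module.End.mul_apply, ha, map_zero]
  obtain ⟨k₁, hk₁⟩ := exists_eq_add_of_ker_pow (H - 2)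
  obtain ⟨k₂, hk₂⟩ := exists_eq_add_of_ker_pow (H + 2)
  obtain ⟨r₀, b, hr₀, hrb⟩ := hk₁ r
  obtain ⟨s₀, c, hs₀, hsc⟩ := hk₂ s
  -- Correct `e` and `f` so that the defects are generalized eigenvectors of `H`.
  set e₁ : L := e - b
  set f₁ : L := f - c
  have he₁ : ⁅h, e₁⁆ = (2 : K) • e₁ + r₀ := by
    simp only [e₁, lie_sub, hr, hrb, LieSubmodule.coe_add, LinearMap.sub_apply,
      LieSubmodule.coe_sub, hH, two_app, LieSubmodule.coe_smul, smul_sub]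
    abel
  have hf₁ : ⁅h, f₁⁆ = -((2 : K) • f₁) + s₀ := by
    simp only [f₁, lie_sub, hs, hsc, LieSubmodule.coe_add, LinearMap.add_apply,
      hH, two_app, LieSubmodule.coe_smul, smul_sub]
    abel
  have hE₁ (a : A) : ⁅e₁, (a : L)⁆ = E a := by simp only [e₁, sub_lie, hA, hE, sub_zero]
  have hF₁ (a : A) : ⁅f₁, (a : L)⁆ = F a := by simp only [f₁, sub_lie, hA, hF, sub_zero]
  obtain ⟨q₁, hq₁⟩ := mk_eq ⁅e₁, f₁⁆ h (by
    simp only [e₁, f₁, mk_lie, map_sub, mk_a, sub_zero, t.lie_e_f])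
  have hHq : H q₁ = E s₀ - F r₀ := by
    have := leibniz_lie h e₁ f₁
    rw [he₁, hf₁, hq₁, lie_add, lie_self, add_lie, smul_lie, lie_add, lie_neg, lie_smul,
      ← lie_skew (r₀ : L) f₁, hE₁, hF₁, zero_add] at this
    apply Subtype.ext
    rw [LieSubmodule.coe_sub, hH, this]
    abel
  set m := max k₁ k₂ + 1
  have hr₀' := ker_le _ (show k₁ ≤ m - 1 by omega) hr₀
  have hs₀' := ker_le _ (show k₂ ≤ m - 1 by omega) hs₀
  have hq₀ : (H ^ m) q₁ = 0 := by
    rw [pow_succ, Module.End.mul_apply, hHq, map_sub]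
    have h1 := ker_map scE' hs₀'
    have h2 := ker_map scF' hr₀'
    simp only [m, Nat.add_sub_cancel] at h1 h2
    rw [h1, h2, sub_zero]
  set r₁ : A := r₀ - E q₁
  set s₁ : A := s₀ - F q₁
  have hr₁ : ((H - 2) ^ m) r₁ = 0 := by
    rw [map_sub, ker_map scE hq₀, ker_le _ (Nat.sub_le m 1) hr₀', sub_zero]
  have hs₁ : ((H + 2) ^ m) s₁ = 0 := by
    rw [map_sub, ker_map scF hq₀, ker_le _ (Nat.sub_le m 1) hs₀', sub_zero]
  -- Correct `e` once more; the remaining defect is then killed by `E` and has negative weight.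
  obtain ⟨d, hd, hTd⟩ := exists_mem_ker_pow_of_mem_ker_pow hHE hHF hEF
    (show ((H - 2) ^ m) (-r₁) = 0 by rw [map_neg, hr₁, neg_zero])
  set e₂ : L := e₁ + d
  set h₂ : L := ⁅e₂, f₁⁆
  have hh₂ : h₂ = h + q₁ - F d := by
    simp only [h₂, e₂, add_lie, hq₁, ← lie_skew (d : L) f₁, hF₁]
    abel
  have hH₂ (a : A) : ⁅h₂, (a : L)⁆ = H a := by
    simp only [hh₂, sub_lie, add_lie, hA, hH, sub_zero, add_zero]
  have hqe (a : A) : ⁅(a : L), e₁⁆ = -(E a : A) := by rw [← lie_skew, hE₁]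
  have hqf (a : A) : ⁅(a : L), f₁⁆ = -(F a : A) := by rw [← lie_skew, hF₁]
  have he₂ : ⁅h₂, e₂⁆ = (2 : K) • e₂ := by
    have hTd' : ((H d : A) : L) - (2 : K) • (d : L) + (E (F d) : A) = -r₁ :=
      congrArg Subtype.val hTd
    have h1 : ⁅h₂, e₁⁆ = (2 : K) • e₁ + r₁ + (E (F d) : A) := by
      simp only [hh₂, sub_lie, add_lie, he₁, hqe, r₁, LieSubmodule.coe_sub]
      abel
    rw [lie_add, hH₂, h1, smul_add]
    have h2 : ((H d : A) : L) = -r₁ - (E (F d) : A) + (2 : K) • (d : L) := by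
      rw [← hTd']; abel
    rw [h2]
    abel
  set s₂ : A := s₁ + F (F d)
  have hs₂ : ((H + 2) ^ m) s₂ = 0 := by
    rw [map_add, hs₁, ker_map scF (ker_map scF' hd), add_zero]
  have hf₂ : ⁅h₂, f₁⁆ = -((2 : K) • f₁) + s₂ := by
    simp only [hh₂, sub_lie, add_lie, hf₁, hqf, s₂, s₁, LieSubmodule.coe_sub, LieSubmodule.coe_add]
    abel
  have hEs : E s₂ = 0 := by
    have := leibniz_lie h₂ e₂ f₁
    rw [he₂, hf₂, lie_self, smul_lie, lie_add, lie_neg, lie_smul] at this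
    apply Subtype.ext
    rw [← hE₁ s₂]
    have h3 : ⁅e₂, (s₂ : L)⁆ = ⁅e₁, (s₂ : L)⁆ := by simp only [e₂, add_lie, hA, add_zero]
    rw [← h3, LieSubmodule.coe_zero, this]
    abel
  have hs₂0 := eq_zero_of_E_eq_zero_of_mem_ker_pow hHE hHF hEF hs₂ hEs
  refine ⟨h₂, e₂, f₁, fun h0 => t.h_ne_zero ?_, rfl, by rw [he₂, two_smul, two_smul], ?_⟩
  · have := congrArg (LieSubmodule.Quotient.mk' A) (hh₂.symm.trans h0)
    simpa only [map_sub, map_add, mk_a, add_zero, sub_zero, map_zero] using this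
  · rw [hf₂, hs₂0, LieSubmodule.coe_zero, add_zero, two_smul, two_smul]

end Lifting

open Module LieAlgebra in
lemma LieAlgebra.isSolvable_of_isLieAbelian_of_quotient {K L : Type*} [Field K] [LieRing L]
    [LieAlgebra K L] (A : LieIdeal K L) [IsLieAbelian A] (h : IsSolvable (L ⧸ A)) :
    IsSolvable L := by
  obtain ⟨k, hk⟩ := (isSolvable_iff K (L ⧸ A)).mp h
  let π : L →ₗ⁅K⁆ L ⧸ A :=
    { (LieSubmodule.Quotient.mk' A : L →ₗ[K] L ⧸ A) with map_lie' := rfl }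
  have h1 : derivedSeries K L k ≤ A := by
    intro x hx
    have h2 := LieIdeal.derivedSeries_map_le (f := π) k (LieIdeal.mem_map hx)
    rw [hk, LieSubmodule.mem_bot] at h2
    exact (LieSubmodule.Quotient.mk_eq_zero' (N := A)).mp h2
  refine IsSolvable.mk (R := K) (k := 1 + k) ?_
  rw [derivedSeries_def, derivedSeriesOfIdeal_add, eq_bot_iff]
  refine (derivedSeriesOfIdeal_mono h1 1).trans ?_
  rw [(abelian_iff_derived_one_eq_bot A).mp inferInstance]

open Module LieAlgebra in
theorem LieAlgebra.exists_isSl2Triple_of_not_isSolvable {K : Type*} [Field K] [CharZero K]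
    [IsAlgClosed K] (L : Type*) [LieRing L] [LieAlgebra K L] [FiniteDimensional K L]
    (hL : ¬ IsSolvable L) : ∃ h e f : L, IsSl2Triple h e f := by
  induction hn : finrank K L using Nat.strong_induction_on generalizing L with
  | _ n ih =>
  by_cases htr : HasTrivialRadical K L
  · obtain ⟨x, hx⟩ := LieAlgebra.exists_isCartanSubalgebra_engel K L
    set H := LieSubalgebra.engel K x
    obtain ⟨α, hα⟩ : ∃ α : LieModule.Weight K H L, α.IsNonZero := by
      by_contra! hα
      have h1 : (⊤ : LieSubmodule K H L) ≤ rootSpace H 0 := by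
        rw [← LieModule.iSup_genWeightSpace_eq_top' K H L]
        exact iSup_le fun χ => by rw [(hα χ).eq]
      rw [rootSpace_zero_eq] at h1
      have h2 : H = ⊤ := eq_top_iff.mpr fun y _ => h1 (LieSubmodule.mem_top y)
      have h3 : LieRing.IsNilpotent H := inferInstance
      rw [h2] at h3
      refine hL ((solvable_iff_equiv_solvable (LieSubalgebra.topEquiv (R := K) (L := L))).mp ?_)
      infer_instance
    obtain ⟨h, e, f, t, -⟩ := IsKilling.exists_isSl2Triple_of_weight_isNonZero hα
    exact ⟨h, e, f, t⟩
  · rw [hasTrivialRadical_iff_no_abelian_ideals] at htr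
    push Not at htr
    obtain ⟨A, hA, hA0⟩ := htr
    have hdim : finrank K (L ⧸ A) < finrank K L := by
      have h1 := A.toSubmodule.finrank_quotient_add_finrank
      have h2 : 0 < finrank K A.toSubmodule := by
        rw [Nat.pos_iff_ne_zero, ne_eq, Submodule.finrank_eq_zero]
        simpa using hA0
      exact (Nat.lt_add_of_pos_right h2).trans_eq h1
    obtain ⟨h, e, f, t⟩ := ih _ (hn ▸ hdim) (L ⧸ A)
      (fun h => hL (isSolvable_of_isLieAbelian_of_quotient A h)) rfl
    exact A.exists_isSl2Triple_of_quotient t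

section Trace

open Module

variable {K V : Type*} [Field K] [AddCommGroup V] [Module K V] [FiniteDimensional K V]

lemma Module.End.trace_mul_self_eq_sum [IsAlgClosed K] (f : End K V) (s : Finset K)
    (hs : ∀ μ, f.HasEigenvalue μ → μ ∈ s) :
    LinearMap.trace K V (f * f) = ∑ μ ∈ s, finrank K (f.maxGenEigenspace μ) * μ ^ 2 := by
  classical
  have hds := DirectSum.isInternal_submodule_of_iSupIndep_of_iSup_eq_top
    f.independent_maxGenEigenspace (iSup_maxGenEigenspace_eq_top f)
  have hfin : {μ | f.maxGenEigenspace μ ≠ ⊥}.Finite :=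
    WellFoundedGT.finite_ne_bot_of_iSupIndep f.independent_maxGenEigenspace
  have hf (μ : K) := f.mapsTo_maxGenEigenspace_of_comm (Commute.refl _) μ
  have hff (μ : K) : Set.MapsTo (f * f) (f.maxGenEigenspace μ) (f.maxGenEigenspace μ) :=
    fun x hx => hf μ (hf μ hx)
  rw [LinearMap.trace_eq_sum_trace_restrict' hds hfin hff]
  have hsub : hfin.toFinset ⊆ s := by
    intro μ hμ
    refine hs μ ?_
    have h1 : f.maxGenEigenspace μ ≠ ⊥ := by simpa using hμ
    rw [hasEigenvalue_iff]
    intro h2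
    refine h1 ((Submodule.eq_bot_iff _).mpr fun x hx => ?_)
    obtain ⟨k, hk⟩ := f.mem_maxGenEigenspace μ x |>.mp hx
    by_contra hx0
    obtain ⟨j, hj, hj'⟩ := exists_last_nonzero_pow _ hx0 hk
    have h3 : ((f - μ • 1) ^ j) x ∈ f.eigenspace μ := by
      rw [Module.End.mem_eigenspace_iff]
      rw [LinearMap.sub_apply, sub_eq_zero] at hj'
      exact hj'
    rw [h2] at h3
    exact hj h3
  rw [Finset.sum_subset_zero_on_sdiff hsub (g := fun μ => finrank K (f.maxGenEigenspace μ) * μ ^ 2)]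
  · intro μ hμ
    have : f.maxGenEigenspace μ = ⊥ := by simpa using (Finset.mem_sdiff.mp hμ).2
    rw [this]
    simp
  · intro μ _
    have hn : IsNilpotent (f.restrict (hf μ) - algebraMap K (End K (f.maxGenEigenspace μ)) μ) :=
      f.isNilpotent_restrict_maxGenEigenspace_sub_algebraMap μ
    have h1 : (f * f).restrict (hff μ) = f.restrict (hf μ) ∘ₗ f.restrict (hf μ) := rfl
    have h2 := LinearMap.trace_comp_eq_mul_of_commute_of_isNilpotent μ
      (Commute.one_left (f.restrict (hf μ))) hn
    have h3 : (1 : End K (f.maxGenEigenspace μ)) ∘ₗ f.restrict (hf μ) = f.restrict (hf μ) := rfl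
    rw [h1, LinearMap.trace_comp_eq_mul_of_commute_of_isNilpotent μ (Commute.refl _) hn, ← h3, h2,
      LinearMap.trace_one]
    ring

end Trace

section Sl2KillingForm

open Module LieAlgebra

variable {K L : Type*} [Field K] [CharZero K] [LieRing L] [LieAlgebra K L]
  [FiniteDimensional K L] {h e f : L}

lemma IsSl2Triple.exists_int_of_hasEigenvalue (t : IsSl2Triple h e f) {μ : K}
    (hμ : (ad K L h).HasEigenvalue μ) : ∃ z : ℤ, μ = z := by
  obtain ⟨v, hv⟩ := hμ.exists_hasEigenvector
  have hv0 : v ≠ 0 := hv.2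
  have hhv : ⁅h, v⁆ = μ • v := hv.apply_eq_smul
  obtain ⟨k, hk⟩ : ∃ k : ℕ, ((LieModule.toEnd K L L e) ^ k) v = 0 := by
    by_contra! hne
    have hinj : Function.Injective fun k : ℕ => (μ + 2 * k : K) := fun a b hab => by
      simpa using hab
    have hli := Module.End.eigenvectors_linearIndependent' (ad K L h) _ hinj
      (fun k => ((LieModule.toEnd K L L e) ^ k) v)
      (fun k => ⟨Module.End.mem_eigenspace_iff.mpr (t.lie_h_pow_toEnd_e hhv k), hne k⟩)
    have := hli.finite_of_isNoetherian
    exact not_finite ℕ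
  obtain ⟨j, hj, hj'⟩ := exists_last_nonzero_pow _ hv0 hk
  have P : t.HasPrimitiveVectorWith (((LieModule.toEnd K L L e) ^ j) v) (μ + 2 * j) :=
    ⟨hj, t.lie_h_pow_toEnd_e hhv j, hj'⟩
  obtain ⟨n, hn⟩ := P.exists_nat
  exact ⟨n - 2 * j, by push_cast; rw [← hn]; ring⟩

lemma IsSl2Triple.killingForm_h_h_ne_zero [IsAlgClosed K] (t : IsSl2Triple h e f) :
    killingForm K L h h ≠ 0 := by
  classical
  set s := (Module.End.finite_hasEigenvalue (ad K L h)).toFinset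
  have htr : killingForm K L h h =
      ∑ μ ∈ s, finrank K ((ad K L h).maxGenEigenspace μ) * μ ^ 2 := by
    rw [killingForm_apply_apply]
    exact Module.End.trace_mul_self_eq_sum _ s (fun μ hμ => by simpa [s] using hμ)
  have hz : ∀ μ ∈ s, ∃ z : ℤ, μ = z := fun μ hμ =>
    t.exists_int_of_hasEigenvalue (by simpa [s] using hμ)
  choose! z hz using hz
  have htr' : killingForm K L h h =
      ((∑ μ ∈ s, finrank K ((ad K L h).maxGenEigenspace μ) * z μ ^ 2 : ℤ) : K) := by
    rw [htr]
    push_cast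
    exact Finset.sum_congr rfl fun μ hμ => by rw [← hz μ hμ]
  rw [htr', Int.cast_ne_zero]
  have he : e ∈ (ad K L h).eigenspace 2 :=
    Module.End.mem_eigenspace_iff.mpr (t.lie_h_e_smul K)
  have h2 : (2 : K) ∈ s := by
    simp only [s, Set.Finite.mem_toFinset, Set.mem_ofPred_eq]
    exact Module.End.hasEigenvalue_of_hasEigenvector ⟨he, t.e_ne_zero⟩
  refine ne_of_gt (Finset.sum_pos' (fun μ _ => by positivity) ⟨2, h2, ?_⟩)
  have hz2 : z 2 ≠ 0 := by
    intro h0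
    have := hz 2 h2
    rw [h0, Int.cast_zero] at this
    exact two_ne_zero this
  have : 0 < finrank K ((ad K L h).maxGenEigenspace 2) := by
    rw [finrank_pos_iff_exists_ne_zero]
    exact ⟨⟨e, (Module.End.eigenspace_le_genEigenspace one_pos).trans
      (Module.End.genEigenspace_le_maximal _ _ 1) he⟩, fun h0 => t.e_ne_zero (by simpa using h0)⟩
  positivity

end Sl2KillingForm

section KillingForm

open Module LieAlgebra

variable {K L : Type*} [Field K] [LieRing L] [LieAlgebra K L]

lemma IsSl2Triple.killingForm_h_h_eq_zero {h e f : L} (t : IsSl2Triple h e f)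
    (D : LinearMap.BilinForm K L) (hD : ∀ x y z, D ⁅x, y⁆ z = D x ⁅y, z⁆ - D y ⁅x, z⁆)
    (hK : ∀ x y, killingForm K L x y = D x y + D y x) : killingForm K L h h = 0 := by
  have hhe := t.lie_h_e_smul K
  have hhf := t.lie_lie_smul_f K
  have heh : ⁅e, h⁆ = -((2 : K) • e) := by rw [← lie_skew, hhe]
  have hfh : ⁅f, h⁆ = (2 : K) • f := by rw [← lie_skew, hhf, neg_neg]
  have h1 : D h h = 2 * killingForm K L e f := by
    conv_lhs => rw [← t.lie_e_f]
    rw [hD, t.lie_e_f, heh, hfh, hK]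
    simp only [map_neg, map_smul, smul_eq_mul]
    ring
  have h2 : killingForm K L h h = 2 * killingForm K L e f := by
    conv_lhs => rw [← t.lie_e_f]
    rw [LieModule.traceForm_apply_lie_apply, t.lie_e_f, hfh, map_smul, smul_eq_mul]
  have h3 := hK h h
  rw [h1] at h3
  linear_combination 2 * h2 - h3

lemma killingForm_lie_left (x y z : L) : killingForm K L ⁅x, y⁆ z = -killingForm K L y ⁅x, z⁆ := by
  rw [← lie_skew, map_neg, LinearMap.neg_apply, LieModule.traceForm_apply_lie_apply]

variable [FiniteDimensional K L]

lemma LinearMap.BilinForm.Nondegenerate.exists_endomorphism {g : LinearMap.BilinForm K L}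
    (hg : g.Nondegenerate) (b : LinearMap.BilinForm K L) :
    ∃ φ : L →ₗ[K] L, ∀ x y, g (φ x) y = b x y := by
  refine ⟨(g.toDual hg).symm.toLinearMap ∘ₗ b, fun x y => ?_⟩
  simp [LinearMap.BilinForm.apply_toDual_symm_apply]

/-- If the Killing form of a Lie algebra is the symmetrization of a derivation with values in the
dual, then so is the Killing form of every scalar extension. -/
lemma exists_baseChange_killingForm_eq (A : Type*) [Field A] [Algebra K A]
    (D : LinearMap.BilinForm K L) (hD : ∀ x y z, D ⁅x, y⁆ z = D x ⁅y, z⁆ - D y ⁅x, z⁆)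
    (hK : ∀ x y, killingForm K L x y = D x y + D y x) :
    ∃ D' : LinearMap.BilinForm A (TensorProduct K A L),
      (∀ x y z, D' ⁅x, y⁆ z = D' x ⁅y, z⁆ - D' y ⁅x, z⁆) ∧
      ∀ x y, killingForm A (TensorProduct K A L) x y = D' x y + D' y x := by
  refine ⟨LinearMap.BilinForm.baseChange A D, fun x y z => ?_, fun x y => ?_⟩
  · induction x using TensorProduct.induction_on with
    | zero => simp
    | add x₁ x₂ h₁ h₂ => simp only [add_lie, map_add, LinearMap.add_apply, h₁, h₂]; abel
    | tmul a x =>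
      induction y using TensorProduct.induction_on with
      | zero => simp
      | add y₁ y₂ h₁ h₂ =>
        simp only [lie_add, add_lie, map_add, LinearMap.add_apply, h₁, h₂]; abel
      | tmul b y =>
        induction z using TensorProduct.induction_on with
        | zero => simp
        | add z₁ z₂ h₁ h₂ => simp only [lie_add, map_add, h₁, h₂]; abel
        | tmul c z =>
          simp only [LieAlgebra.ExtendScalars.bracket_tmul, LinearMap.BilinForm.baseChange_tmul, hD]
          simp only [Algebra.smul_def, map_sub]
          ring
  · have hbc : killingForm A (TensorProduct K A L) = (killingForm K L).baseChange A :=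
      LieModule.traceForm_baseChange K L L A
    rw [hbc]
    induction x using TensorProduct.induction_on with
    | zero => simp
    | add x₁ x₂ h₁ h₂ => simp only [map_add, LinearMap.add_apply, h₁, h₂]; abel
    | tmul a x =>
      induction y using TensorProduct.induction_on with
      | zero => simp
      | add y₁ y₂ h₁ h₂ => simp only [map_add, LinearMap.add_apply, h₁, h₂]; abel
      | tmul b y =>
        simp only [LinearMap.BilinForm.baseChange_tmul, hK]
        simp only [Algebra.smul_def, map_add]
        ring

variable [CharZero K]

/-- A Lie algebra whose Killing form is the symmetrization of a derivation with values in the dual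
is solvable. -/
theorem LieAlgebra.isSolvable_of_killingForm_eq (D : LinearMap.BilinForm K L)
    (hD : ∀ x y z, D ⁅x, y⁆ z = D x ⁅y, z⁆ - D y ⁅x, z⁆)
    (hK : ∀ x y, killingForm K L x y = D x y + D y x) : IsSolvable L := by
  let A := AlgebraicClosure K
  obtain ⟨D', hD', hK'⟩ := exists_baseChange_killingForm_eq A D hD hK
  rw [← isSolvable_tensorProduct_iff K (A := A) (L := L)]
  by_contra hns
  have : CharZero A := algebraRat.charZero A
  obtain ⟨h, e, f, t⟩ := exists_isSl2Triple_of_not_isSolvable (K := A) _ hns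
  exact t.killingForm_h_h_ne_zero (K := A) (t.killingForm_h_h_eq_zero D' hD' hK')

theorem IsCotangentSolitary.isSolvable (hL : IsCotangentSolitary K L) : IsSolvable L := by
  obtain ⟨D, hD⟩ := hL (killingForm K L)
    (fun x y => LinearMap.ext fun z => killingForm_lie_left x y z)
    (fun x y => LieModule.traceForm_comm K L L x y)
  refine isSolvable_of_killingForm_eq (D : L →ₗ[K] Module.Dual K L) (fun x y z => ?_) hD
  have h := congrArg (fun α : Module.Dual K L => α z) (D.apply_lie_eq_sub x y)
  have h' : D ⁅x, y⁆ z = -D y ⁅x, z⁆ - -D x ⁅y, z⁆ := h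
  change D ⁅x, y⁆ z = D x ⁅y, z⁆ - D y ⁅x, z⁆
  rw [h']
  abel

lemma IsAdInvariantMetric.isSolvable_of_killingForm_eq {g : LinearMap.BilinForm K L}
    (hg : IsAdInvariantMetric g) (D : LieDerivation K L L)
    (hD : ∀ x y, killingForm K L x y = g (D x) y + g x (D y)) : IsSolvable L := by
  refine LieAlgebra.isSolvable_of_killingForm_eq (g ∘ₗ D.toLinearMap) (fun x y z => ?_)
    fun x y => (hD x y).trans ?_
  · change g (D ⁅x, y⁆) z = g (D x) ⁅y, z⁆ - g (D y) ⁅x, z⁆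
    have h1 : g ⁅y, D x⁆ z = -g (D x) ⁅y, z⁆ := hg.invariant y (D x) z
    have h2 : g ⁅x, D y⁆ z = -g (D y) ⁅x, z⁆ := hg.invariant x (D y) z
    rw [D.apply_lie_eq_sub, map_sub, LinearMap.sub_apply, h1, h2]
    abel
  · have h1 : g x (D y) = g (D y) x := hg.symm.eq x (D y)
    rw [h1]
    rfl

theorem IsSolitary.isSolvable (hL : IsSolitary K L) : IsSolvable L := by
  obtain ⟨g, hg, hs⟩ := hL
  obtain ⟨φ, hφ⟩ := hg.nondegenerate.exists_endomorphism (killingForm K L)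
  have hinv : ∀ x y, φ ⁅x, y⁆ = ⁅x, φ y⁆ := fun x y => by
    refine sub_eq_zero.mp (hg.nondegenerate.1 _ fun z => ?_)
    have h1 : g ⁅x, φ y⁆ z = -g (φ y) ⁅x, z⁆ := hg.invariant x (φ y) z
    rw [map_sub, LinearMap.sub_apply, h1, hφ, hφ, killingForm_lie_left, sub_self]
  have hself : g.IsSelfAdjoint φ := fun x y => by
    rw [hφ, LieModule.traceForm_comm, ← hφ]
    exact hg.symm.eq _ _
  obtain ⟨D, D', hDD', hφD⟩ := hs φ hinv hself
  refine hg.isSolvable_of_killingForm_eq D fun x y => ?_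
  have h1 : g (D' x) y = g x (D y) := by
    have h2 : g (D y) x = g y (D' x) := hDD' y x
    exact (hg.symm.eq _ _).trans (h2.symm.trans (hg.symm.eq _ _))
  rw [← hφ, hφD, LinearMap.add_apply, map_add, LinearMap.add_apply, h1]
  rfl

end KillingForm

section Logarithm

open Module Polynomial

variable {K V : Type*} [Field K] [CharZero K] [AddCommGroup V] [Module K V]

/-- The polynomial whose value at a natural number `k` is the binomial coefficient `k.choose j`. -/
noncomputable def choosePoly (K : Type*) [Field K] (j : ℕ) : K[X] :=
  C ((j.factorial : K)⁻¹) * descPochhammer K j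

lemma choosePoly_eval_natCast (j k : ℕ) : (choosePoly K j).eval (k : K) = k.choose j := by
  have hj : (j.factorial : K) ≠ 0 := Nat.cast_ne_zero.mpr j.factorial_ne_zero
  rw [choosePoly, eval_mul, eval_C, descPochhammer_eval_eq_descFactorial,
    Nat.descFactorial_eq_factorial_mul_choose, Nat.cast_mul, inv_mul_cancel_left₀ hj]

/-- The logarithm of `1 + N`, if `N ^ m = 0`. -/
noncomputable def Module.End.logOneAdd (m : ℕ) (N : End K V) : End K V :=
  ∑ j ∈ Finset.range m, (derivative (choosePoly K j)).eval 0 • N ^ j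

lemma Module.End.one_add_pow_eq_sum {m : ℕ} {N : End K V} (hN : N ^ m = 0) (k : ℕ) :
    (1 + N) ^ k = ∑ j ∈ Finset.range m, (choosePoly K j).eval (k : K) • N ^ j := by
  have h0 (j : ℕ) (hj : m ≤ j) : N ^ j = 0 := pow_eq_zero_of_le hj hN
  have h1 : (1 + N) ^ k = ∑ j ∈ Finset.range (k + 1 + m), (k.choose j : K) • N ^ j := by
    rw [add_comm, (Commute.one_right N).add_pow]
    refine Finset.sum_subset_zero_on_sdiff (Finset.range_subset_range.mpr (Nat.le_add_right _ _))
      (fun j hj => ?_) fun j _ => ?_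
    · rw [Nat.choose_eq_zero_of_lt (by simp at hj; omega), Nat.cast_zero, zero_smul]
    · rw [one_pow, mul_one, ← nsmul_eq_mul', Nat.cast_smul_eq_nsmul]
  rw [h1]
  symm
  refine Finset.sum_subset_zero_on_sdiff (Finset.range_subset_range.mpr (Nat.le_add_left _ _))
    (fun j hj => ?_) fun j _ => ?_
  · rw [h0 j (by simp at hj; omega), smul_zero]
  · rw [choosePoly_eval_natCast]

lemma Module.End.bilin_logOneAdd_add {m : ℕ} {N : End K V} (hN : N ^ m = 0)
    (b : LinearMap.BilinForm K V) (x y : V) (p : K[X])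
    (hp : ∀ k : ℕ, b (((1 + N) ^ k) x) (((1 + N) ^ k) y) = p.eval (k : K)) :
    b (logOneAdd m N x) y + b x (logOneAdd m N y) = (derivative p).eval 0 := by
  set q : K[X] := ∑ i ∈ Finset.range m, ∑ j ∈ Finset.range m,
    C (b ((N ^ i) x) ((N ^ j) y)) * (choosePoly K i * choosePoly K j) with hq
  have hpq : q = p := by
    refine Polynomial.eq_of_infinite_eval_eq q p
      ((Set.infinite_range_of_injective (Nat.cast_injective (R := K))).mono ?_)
    rintro _ ⟨k, rfl⟩
    change q.eval (k : K) = p.eval (k : K)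
    rw [← hp, one_add_pow_eq_sum hN, hq]
    simp only [eval_finsetSum, eval_mul, eval_C, LinearMap.sum_apply, LinearMap.smul_apply,
      map_sum, map_smul, smul_eq_mul, Finset.mul_sum]
    rw [Finset.sum_comm]
    refine Finset.sum_congr rfl fun i _ => Finset.sum_congr rfl fun j _ => ?_
    ring
  have h0 (z : V) : z = ∑ j ∈ Finset.range m, (choosePoly K j).eval 0 • (N ^ j) z := by
    have := one_add_pow_eq_sum hN 0
    rw [pow_zero, Nat.cast_zero] at this
    simpa using LinearMap.congr_fun this z
  have h1 : b (logOneAdd m N x) y = ∑ i ∈ Finset.range m, ∑ j ∈ Finset.range m,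
      b ((N ^ i) x) ((N ^ j) y) *
        ((derivative (choosePoly K i)).eval 0 * (choosePoly K j).eval 0) := by
    conv_lhs => rw [h0 y]
    simp only [logOneAdd, LinearMap.sum_apply, LinearMap.smul_apply, map_sum, map_smul, smul_eq_mul,
      Finset.mul_sum]
    rw [Finset.sum_comm]
    exact Finset.sum_congr rfl fun i _ => Finset.sum_congr rfl fun j _ => by ring
  have h2 : b x (logOneAdd m N y) = ∑ i ∈ Finset.range m, ∑ j ∈ Finset.range m,
      b ((N ^ i) x) ((N ^ j) y) *
        ((choosePoly K i).eval 0 * (derivative (choosePoly K j)).eval 0) := by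
    conv_lhs => rw [h0 x]
    simp only [logOneAdd, LinearMap.sum_apply, LinearMap.smul_apply, map_sum, map_smul, smul_eq_mul,
      Finset.mul_sum]
    rw [Finset.sum_comm]
    exact Finset.sum_congr rfl fun i _ => Finset.sum_congr rfl fun j _ => by ring
  rw [← hpq, hq, h1, h2, ← Finset.sum_add_distrib]
  simp only [map_sum, derivative_mul, derivative_C, zero_mul, zero_add, eval_finsetSum, eval_add,
    eval_mul, eval_C, ← Finset.sum_add_distrib, mul_add]

variable {L : Type*} [LieRing L] [LieAlgebra K L]

/-- The logarithm of a unipotent automorphism of a Lie algebra is a derivation. -/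
noncomputable def LieDerivation.logOneAdd {m : ℕ} {N : End K L} (hN : N ^ m = 0)
    (hU : ∀ x y, (1 + N) ⁅x, y⁆ = ⁅(1 + N) x, (1 + N) y⁆) : LieDerivation K L L where
  toLinearMap := Module.End.logOneAdd m N
  leibniz' x y := by
    rw [← sub_eq_zero, ← Module.forall_dual_apply_eq_zero_iff K]
    intro ℓ
    have hk (k : ℕ) : ((1 + N) ^ k) ⁅x, y⁆ = ⁅((1 + N) ^ k) x, ((1 + N) ^ k) y⁆ := by
      induction k with
      | zero => rfl
      | succ k ih => simp only [pow_succ', Module.End.mul_apply, ih, hU]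
    have h := Module.End.bilin_logOneAdd_add hN
      ((LieModule.toEnd K L L : L →ₗ[K] End K L).compr₂ ℓ) x y
      (∑ j ∈ Finset.range m, C (ℓ ((N ^ j) ⁅x, y⁆)) * choosePoly K j) (fun k => by
        change ℓ ⁅((1 + N) ^ k) x, ((1 + N) ^ k) y⁆ = _
        rw [← hk, Module.End.one_add_pow_eq_sum hN]
        simp only [eval_finsetSum, eval_mul, eval_C, LinearMap.sum_apply, LinearMap.smul_apply,
          map_sum, map_smul, smul_eq_mul]
        exact Finset.sum_congr rfl fun j _ => mul_comm _ _)
    replace h : ℓ ⁅Module.End.logOneAdd m N x, y⁆ + ℓ ⁅x, Module.End.logOneAdd m N y⁆ =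
        ℓ (Module.End.logOneAdd m N ⁅x, y⁆) := by
      refine Eq.trans h ?_
      simp only [map_sum, derivative_mul, derivative_C, zero_mul, zero_add, eval_finsetSum,
        eval_mul, eval_C, Module.End.logOneAdd, LinearMap.sum_apply, LinearMap.smul_apply,
        map_smul, smul_eq_mul]
      exact Finset.sum_congr rfl fun j _ => mul_comm _ _
    rw [map_sub, map_sub, ← h, ← lie_skew (Module.End.logOneAdd m N x) y, map_neg]
    ring

lemma exists_lieDerivation_of_isNilpotent {N : End K L} (hN : IsNilpotent N)
    (hU : ∀ x y, (1 + N) ⁅x, y⁆ = ⁅(1 + N) x, (1 + N) y⁆) (g B : LinearMap.BilinForm K L)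
    (hg : ∀ x y, g ((1 + N) x) ((1 + N) y) = g x y + B x y)
    (hB : ∀ x y, B ((1 + N) x) ((1 + N) y) = B x y) :
    ∃ D : LieDerivation K L L, ∀ x y, B x y = g (D x) y + g x (D y) := by
  obtain ⟨m, hm⟩ := hN
  refine ⟨LieDerivation.logOneAdd hm hU, fun x y => ?_⟩
  have hBk (k : ℕ) (x y : L) : B (((1 + N) ^ k) x) (((1 + N) ^ k) y) = B x y := by
    induction k with
    | zero => rfl
    | succ k ih => simp only [pow_succ', Module.End.mul_apply, ih, hB]
  have h := Module.End.bilin_logOneAdd_add hm g x y (C (g x y) + C (B x y) * X) (fun k => by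
    simp only [eval_add, eval_mul, eval_C, eval_X]
    induction k with
    | zero => simp
    | succ k ih =>
      simp only [pow_succ', Module.End.mul_apply, hg, hBk, ih]
      push_cast
      ring)
  simp only [derivative_add, derivative_mul, derivative_C, derivative_X, zero_mul, mul_one,
    zero_add, eval_C] at h
  exact h.symm

end Logarithm

/-- If `a + b`, `c + d` and `u + v` are sums of commuting elements, with `a`, `c`, `u` nilpotent, then
`(a + b) * (c + d) - (u + v)` is the sum of `b * d - v` and of a nilpotent element commuting with
it. -/
lemma nilpotent_part_mul_sub {R : Type*} [Ring R] {a b c d u v : R} (hab : Commute a b)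
    (hcd : Commute c d) (huv : Commute u v) (hac : Commute a c) (had : Commute a d)
    (hbc : Commute b c) (hbd : Commute b d) (hau : Commute a u) (hav : Commute a v)
    (hbu : Commute b u) (hbv : Commute b v) (hcu : Commute c u) (hcv : Commute c v)
    (hdu : Commute d u) (hdv : Commute d v) (ha : IsNilpotent a) (hc : IsNilpotent c)
    (hu : IsNilpotent u) :
    IsNilpotent (a * (c + d) + b * c - u) ∧ Commute (b * d - v) (a * (c + d) + b * c - u) ∧
      (a + b) * (c + d) - (u + v) = b * d - v + (a * (c + d) + b * c - u) := by
  have s₁ : Commute a (b * d - v) := (hab.mul_right had).sub_right hav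
  have s₂ : Commute c (b * d - v) := (hbc.symm.mul_right hcd).sub_right hcv
  have s₃ : Commute u (b * d - v) := (hbu.symm.mul_right hdu.symm).sub_right huv
  have t₁ : Commute b (b * d - v) := ((Commute.refl _).mul_right hbd).sub_right hbv
  have t₂ : Commute d (b * d - v) := (hbd.symm.mul_right (Commute.refl _)).sub_right hdv
  have hN₁ : IsNilpotent (a * (c + d)) := (hac.add_right had).isNilpotent_mul_right ha
  have hN₂ : IsNilpotent (b * c) := hbc.isNilpotent_mul_left hc
  have hN₁₂ : Commute (a * (c + d)) (b * c) :=
    (hab.mul_right hac).mul_left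
      ((hbc.symm.add_left hbd.symm).mul_right ((Commute.refl _).add_left hcd.symm))
  have hN₃ : Commute (a * (c + d) + b * c) u :=
    (hau.mul_left (hcu.add_left hdu)).add_left (hbu.mul_left hcu)
  refine ⟨hN₃.isNilpotent_sub (hN₁₂.isNilpotent_add hN₁ hN₂) hu,
    (((s₁.mul_left (s₂.add_left t₂)).add_left (t₁.mul_left s₂)).sub_left s₃).symm, ?_⟩
  noncomm_ring

section JordanChevalley

open Module

variable {K V M : Type*} [Field K] [AddCommGroup V] [Module K V] [AddCommGroup M] [Module K M]

lemma Module.End.IsSemisimple.apply_eq_zero_of_pow_add_apply_eq_zero {S N : End K V}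
    (hS : S.IsSemisimple) (hN : IsNilpotent N) (hSN : Commute S N) {k : ℕ} {v : V}
    (hv : ((S + N) ^ k) v = 0) : S v = 0 := by
  obtain ⟨l, hl⟩ := hN
  have hT : Commute (S + N) (-N) := (hSN.add_left (Commute.refl N)).neg_right
  have hpow : (S ^ (k + l)) v = 0 := by
    have hS' : S = S + N + -N := by abel
    rw [hS', hT.add_pow, LinearMap.sum_apply]
    refine Finset.sum_eq_zero fun i hi => ?_
    rcases le_or_gt k i with h | h
    · have h1 : (S + N) ^ i * (-N) ^ (k + l - i) * ((k + l).choose i : End K V) =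
          ((k + l).choose i : End K V) * (-N) ^ (k + l - i) * (S + N) ^ (i - k) * (S + N) ^ k := by
        rw [mul_assoc _ ((S + N) ^ (i - k)), ← pow_add, Nat.sub_add_cancel h,
          (hT.pow_pow _ _).eq, ← (Nat.cast_commute _ _).eq, mul_assoc]
      rw [h1, Module.End.mul_apply, hv, map_zero]
    · rw [neg_pow N, pow_eq_zero_of_le (by omega) hl]
      simp
  have h1 : v ∈ S.maxGenEigenspace 0 :=
    (S.mem_maxGenEigenspace 0 v).mpr ⟨k + l, by simpa using hpow⟩
  rw [hS.isFinitelySemisimple.maxGenEigenspace_eq_eigenspace, Module.End.mem_eigenspace_iff] at h1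
  simpa using h1

lemma Module.End.IsSemisimple.map_of_map_pow [FiniteDimensional K V] (Φ : End K V →ₗ[K] End K M)
    (hΦ : ∀ a k, Φ (a ^ k) = Φ a ^ k) {s : End K V} (hs : s.IsSemisimple) :
    (Φ s).IsSemisimple := by
  refine isSemisimple_of_squarefree_aeval_eq_zero hs.minpoly_squarefree ?_
  have h : Φ (Polynomial.aeval s (minpoly K s)) = 0 := by rw [minpoly.aeval, map_zero]
  rw [← h]
  simp only [Polynomial.aeval_eq_sum_range, map_sum, map_smul, hΦ]

variable (K V M) in
/-- The action of an endomorphism on bilinear maps through the first argument. -/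
def precompFst : End K V →ₗ[K] End K (V →ₗ[K] V →ₗ[K] M) :=
  LinearMap.mk₂ K (fun a G => G ∘ₗ a) (by intros; ext; simp) (by intros; ext; simp)
    (by intros; ext; simp) (by intros; ext; simp)

variable (K V M) in
/-- The action of an endomorphism on bilinear maps through the second argument. -/
def precompSnd : End K V →ₗ[K] End K (V →ₗ[K] V →ₗ[K] M) :=
  LinearMap.mk₂ K (fun a G => G.compl₂ a) (by intros; ext; simp) (by intros; ext; simp)
    (by intros; ext; simp) (by intros; ext; simp)

variable (K V M) in
/-- The action of an endomorphism on bilinear maps through the values. -/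
def postcomp : End K M →ₗ[K] End K (V →ₗ[K] V →ₗ[K] M) :=
  LinearMap.mk₂ K (fun a G => G.compr₂ a) (by intros; ext; simp) (by intros; ext; simp)
    (by intros; ext; simp) (by intros; ext; simp)

@[simp] lemma precompFst_apply (a : End K V) (G : V →ₗ[K] V →ₗ[K] M) (x y : V) :
    precompFst K V M a G x y = G (a x) y := rfl

@[simp] lemma precompSnd_apply (a : End K V) (G : V →ₗ[K] V →ₗ[K] M) (x y : V) :
    precompSnd K V M a G x y = G x (a y) := rfl

@[simp] lemma postcomp_apply (a : End K M) (G : V →ₗ[K] V →ₗ[K] M) (x y : V) :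
    postcomp K V M a G x y = a (G x y) := rfl

lemma precompFst_pow (a : End K V) (k : ℕ) : precompFst K V M (a ^ k) = precompFst K V M a ^ k := by
  induction k with
  | zero => rfl
  | succ k ih => rw [pow_succ' a, pow_succ (precompFst K V M a), ← ih]; rfl

lemma precompSnd_pow (a : End K V) (k : ℕ) : precompSnd K V M (a ^ k) = precompSnd K V M a ^ k := by
  induction k with
  | zero => rfl
  | succ k ih => rw [pow_succ' a, pow_succ (precompSnd K V M a), ← ih]; rfl

lemma postcomp_pow (a : End K M) (k : ℕ) : postcomp K V M (a ^ k) = postcomp K V M a ^ k := by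
  induction k with
  | zero => rfl
  | succ k ih => rw [pow_succ' a, pow_succ' (postcomp K V M a), ← ih]; rfl

lemma commute_precompFst {a b : End K V} (h : Commute a b) :
    Commute (precompFst K V M a) (precompFst K V M b) := by
  ext G x y
  exact congrArg (fun z => G z y) (LinearMap.congr_fun h.eq.symm x)

lemma commute_precompSnd {a b : End K V} (h : Commute a b) :
    Commute (precompSnd K V M a) (precompSnd K V M b) := by
  ext G x y
  exact congrArg (G x) (LinearMap.congr_fun h.eq.symm y)

lemma commute_postcomp {a b : End K M} (h : Commute a b) :
    Commute (postcomp K V M a) (postcomp K V M b) := by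
  ext G x y
  exact LinearMap.congr_fun h.eq (G x y)

lemma commute_precompFst_precompSnd (a b : End K V) :
    Commute (precompFst K V M a) (precompSnd K V M b) := by
  ext; rfl

lemma commute_precompFst_postcomp (a : End K V) (b : End K M) :
    Commute (precompFst K V M a) (postcomp K V M b) := by
  ext; rfl

lemma commute_precompSnd_postcomp (a : End K V) (b : End K M) :
    Commute (precompSnd K V M a) (postcomp K V M b) := by
  ext; rfl

/-- If a bilinear map is equivariant up to a unipotent error for a pair of endomorphisms, then it is
equivariant for their semisimple parts. -/
lemma bilin_apply_semisimple_part [PerfectField K] [FiniteDimensional K V] [FiniteDimensional K M]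
    {n s : End K V} {n' s' : End K M} (hns : Commute n s) (hns' : Commute n' s')
    (hn : IsNilpotent n) (hn' : IsNilpotent n') (hs : s.IsSemisimple) (hs' : s'.IsSemisimple)
    (G : V →ₗ[K] V →ₗ[K] M) {k : ℕ}
    (hG : ((precompFst K V M (n + s) * precompSnd K V M (n + s) -
      postcomp K V M (n' + s')) ^ k) G = 0) (x y : V) :
    G (s x) (s y) = s' (G x y) := by
  set P₁ := precompFst K V M
  set P₂ := precompSnd K V M
  set Q := postcomp K V M
  have nil₁ : IsNilpotent (P₁ n) := by
    obtain ⟨m, hm⟩ := hn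
    exact ⟨m, by rw [← precompFst_pow, hm, map_zero]⟩
  have nil₂ : IsNilpotent (P₂ n) := by
    obtain ⟨m, hm⟩ := hn
    exact ⟨m, by rw [← precompSnd_pow, hm, map_zero]⟩
  have nil₃ : IsNilpotent (Q n') := by
    obtain ⟨m, hm⟩ := hn'
    exact ⟨m, by rw [← postcomp_pow, hm, map_zero]⟩
  have c₁ : Commute (P₁ n) (P₁ s) := commute_precompFst hns
  have c₂ : Commute (P₂ n) (P₂ s) := commute_precompSnd hns
  have c₃ : Commute (Q n') (Q s') := commute_postcomp hns'
  have c₁₂ (a b : End K V) : Commute (P₁ a) (P₂ b) := commute_precompFst_precompSnd a b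
  have c₁₃ (a : End K V) (b : End K M) : Commute (P₁ a) (Q b) := commute_precompFst_postcomp a b
  have c₂₃ (a : End K V) (b : End K M) : Commute (P₂ a) (Q b) := commute_precompSnd_postcomp a b
  have hS : (P₁ s * P₂ s - Q s').IsSemisimple :=
    ((hs.map_of_map_pow P₁ precompFst_pow).mul_of_commute (c₁₂ s s)
      (hs.map_of_map_pow P₂ precompSnd_pow)).sub_of_commute
      ((c₁₃ s s').mul_left (c₂₃ s s')) (hs'.map_of_map_pow Q postcomp_pow)
  obtain ⟨hN, hSN, hsum⟩ := nilpotent_part_mul_sub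
    (R := End K (V →ₗ[K] V →ₗ[K] M)) c₁ c₂ c₃ (c₁₂ n n) (c₁₂ n s) (c₁₂ s n) (c₁₂ s s)
    (c₁₃ n n') (c₁₃ n s') (c₁₃ s n') (c₁₃ s s') (c₂₃ n n') (c₂₃ n s') (c₂₃ s n') (c₂₃ s s')
    nil₁ nil₂ nil₃
  rw [map_add, map_add, map_add, hsum] at hG
  have h0 := hS.apply_eq_zero_of_pow_add_apply_eq_zero hN hSN hG
  exact sub_eq_zero.mp (LinearMap.congr_fun₂ h0 x y)

end JordanChevalley

section Automorphisms

open Module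

variable {K L : Type*} [Field K] [LieRing L] [LieAlgebra K L]

theorem IsAdInvariantMetric.add_smul_killingForm {g : LinearMap.BilinForm K L}
    (hg : IsAdInvariantMetric g) {t : K} (ht : (g + t • killingForm K L).Nondegenerate) :
    IsAdInvariantMetric (g + t • killingForm K L) where
  symm := ⟨fun x y => by
    have h1 : g x y = g y x := hg.symm.eq x y
    change g x y + t * killingForm K L x y = g y x + t * killingForm K L y x
    rw [h1, LieModule.traceForm_comm]⟩
  nondegenerate := ht
  invariant x y z := by
    have h1 : g ⁅x, y⁆ z = -g y ⁅x, z⁆ := hg.invariant x y z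
    change g ⁅x, y⁆ z + t * killingForm K L ⁅x, y⁆ z = -(g y ⁅x, z⁆ + t * killingForm K L y ⁅x, z⁆)
    rw [h1, killingForm_lie_left]
    ring

lemma IsOrthogonalDecomposition.eq_of_eq_on {h h' : LinearMap.BilinForm K L} {n : ℕ}
    {I : Fin n → LieIdeal K L} (hI : IsOrthogonalDecomposition h I)
    (hI' : IsOrthogonalDecomposition h' I)
    (heq : ∀ i, ∀ x ∈ I i, ∀ y ∈ I i, h x y = h' x y) : h = h' := by
  have htop (x : L) : x ∈ ⨆ i, (I i).toSubmodule :=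
    hI.internal.submodule_iSup_eq_top ▸ Submodule.mem_top
  ext x y
  induction htop x using Submodule.iSup_induction' with
  | zero => simp
  | add x₁ x₂ _ _ h₁ h₂ => simp only [map_add, LinearMap.add_apply, h₁, h₂]
  | mem i x hx =>
    induction htop y using Submodule.iSup_induction' with
    | zero => simp
    | add y₁ y₂ _ _ h₁ h₂ => simp only [map_add, h₁, h₂]
    | mem j y hy =>
      by_cases hij : i = j
      · subst hij
        exact heq i x hx y hy
      · rw [hI.orthogonal i j hij x hx y hy, hI'.orthogonal i j hij x hx y hy]

lemma LinearMap.BilinForm.Nondegenerate.infinite_setOf_nondegenerate_add_smul {K V : Type*} [Field K]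
    [AddCommGroup V] [Module K V] [FiniteDimensional K V] [Infinite K]
    {g : LinearMap.BilinForm K V} (hg : g.Nondegenerate) (b : LinearMap.BilinForm K V) :
    {t : K | (g + t • b).Nondegenerate}.Infinite := by
  classical
  let v := Module.finBasis K V
  let G := LinearMap.BilinForm.toMatrix v g
  let B := LinearMap.BilinForm.toMatrix v b
  let p : Polynomial K := (G.map Polynomial.C + (Polynomial.X : Polynomial K) • B.map Polynomial.C).det
  have hp (t : K) : p.eval t = (LinearMap.BilinForm.toMatrix v (g + t • b)).det := by
    rw [← Polynomial.coe_evalRingHom, RingHom.map_det]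
    congr 1
    ext i j
    simp [G, B]
    ring
  have hnd (t : K) : (g + t • b).Nondegenerate ↔ p.eval t ≠ 0 := by
    rw [hp]
    exact LinearMap.BilinForm.nondegenerate_iff_det_ne_zero v
  have hp0 : p ≠ 0 := by
    intro h0
    have := (hnd 0).mp (by simpa using hg)
    simp [h0] at this
  have hfin : {t : K | p.eval t = 0}.Finite := by
    refine (p.roots.toFinset.finite_toSet).subset fun t ht => ?_
    simpa [hp0] using ht
  have : {t : K | (g + t • b).Nondegenerate} = {t : K | p.eval t = 0}ᶜ := by
    ext t
    exact hnd t
  rw [this]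
  exact hfin.infinite_compl

variable [CharZero K] [FiniteDimensional K L]

/-- If an automorphism fixes a bilinear form `B` and adds `B` to a bilinear form `g`, then `B` is the
derivative of `g` along a derivation. -/
lemma LieEquiv.exists_lieDerivation (χ : L ≃ₗ⁅K⁆ L) (g B : LinearMap.BilinForm K L)
    (hg : ∀ x y, g (χ x) (χ y) = g x y + B x y) (hB : ∀ x y, B (χ x) (χ y) = B x y) :
    ∃ D : LieDerivation K L L, ∀ x y, B x y = g (D x) y + g x (D y) := by
  set A : End K L := (χ : L →ₗ[K] L) with hA
  have hAx (x : L) : A x = χ x := rfl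
  obtain ⟨n, hn, s, hs, hnil, hss, hns⟩ := A.exists_isNilpotent_isSemisimple
  have hcomm : Commute n s := Algebra.commute_of_mem_adjoin_singleton_of_commute hs
    (Algebra.commute_of_mem_adjoin_self hn).symm
  have one_nil : IsNilpotent (0 : End K K) := IsNilpotent.zero
  have one_ss : (1 : End K K).IsSemisimple := Module.End.isSemisimple_id
  have hs_lie (x y : L) : s ⁅x, y⁆ = ⁅s x, s y⁆ := by
    refine (bilin_apply_semisimple_part hcomm hcomm hnil hnil hss hss
      (LieModule.toEnd K L L : L →ₗ[K] End K L) (k := 1) ?_ x y).symm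
    rw [← hns, pow_one]
    ext x y
    change ⁅χ x, χ y⁆ - χ ⁅x, y⁆ = 0
    rw [LieEquiv.map_lie, sub_self]
  have hs_B (x y : L) : B (s x) (s y) = B x y := by
    refine bilin_apply_semisimple_part hcomm (Commute.zero_left 1) hnil one_nil hss one_ss
      B (k := 1) ?_ x y
    rw [← hns, pow_one, zero_add]
    ext x y
    change B (χ x) (χ y) - B x y = 0
    rw [hB, sub_self]
  have hs_g (x y : L) : g (s x) (s y) = g x y := by
    refine bilin_apply_semisimple_part hcomm (Commute.zero_left 1) hnil one_nil hss one_ss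
      g (k := 2) ?_ x y
    rw [← hns, pow_two, zero_add]
    ext x y
    change g (χ (χ x)) (χ (χ y)) - g (χ x) (χ y) - (g (χ x) (χ y) - g x y) = 0
    rw [hg, hg, hB]
    ring
  have hunit : IsUnit A := (Module.End.isUnit_iff A).mpr χ.bijective
  have hs_unit : IsUnit s := by
    have h1 : s = A + -n := by rw [hns]; abel
    rw [h1]
    exact hnil.neg.isUnit_add_left_of_commute hunit
      ((hns ▸ (Commute.refl n).add_right hcomm : Commute n A).neg_left)
  obtain ⟨S, rfl⟩ := hs_unit
  set N : End K L := n * (S⁻¹ : (End K L)ˣ)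
  have hN : IsNilpotent N := hcomm.units_inv_right.isNilpotent_mul_right hnil
  have hU : (1 + N) = A * (S⁻¹ : (End K L)ˣ) := by
    rw [hns, add_mul, Units.mul_inv, add_comm]
  have hSS (x : L) : (S : End K L) (((S⁻¹ : (End K L)ˣ) : End K L) x) = x :=
    LinearMap.congr_fun S.mul_inv x
  have hUx (x : L) : (1 + N) x = χ (((S⁻¹ : (End K L)ˣ) : End K L) x) := LinearMap.congr_fun hU x
  refine exists_lieDerivation_of_isNilpotent hN (fun x y => ?_) g B (fun x y => ?_)
    (fun x y => ?_)
  · rw [hUx, hUx, hUx, ← LieEquiv.map_lie]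
    congr 1
    conv_lhs => rw [← hSS x, ← hSS y, ← hs_lie]
    exact LinearMap.congr_fun S.inv_mul _
  · rw [hUx, hUx, hg, ← hs_g, ← hs_B, hSS, hSS]
  · rw [hUx, hUx, hB, ← hs_B, hSS, hSS]

/-- A Lie algebra with an ad-invariant metric is solvable if its ad-invariant metrics lie in finitely
many orbits of the automorphism group. -/
theorem IsAdInvariantMetric.isSolvable_of_finite {g : LinearMap.BilinForm K L}
    (hg : IsAdInvariantMetric g) {F : Set (LinearMap.BilinForm K L)} (hF : F.Finite)
    (h : ∀ g' : LinearMap.BilinForm K L, IsAdInvariantMetric g' →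
      ∃ (ψ : L ≃ₗ⁅K⁆ L), ∃ f ∈ F, ∀ x y : L, g' x y = f (ψ x) (ψ y)) :
    LieAlgebra.IsSolvable L := by
  have hinf := hg.nondegenerate.infinite_setOf_nondegenerate_add_smul (killingForm K L)
  have h' : ∀ t ∈ {t : K | (g + t • killingForm K L).Nondegenerate}, ∃ f ∈ F, ∃ ψ : L ≃ₗ⁅K⁆ L,
      ∀ x y : L, (g + t • killingForm K L) x y = f (ψ x) (ψ y) := fun t ht => by
    obtain ⟨ψ, f, hf, hψ⟩ := h _ (hg.add_smul_killingForm ht)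
    exact ⟨f, hf, ψ, hψ⟩
  choose! f hfF ψ hψ using h'
  obtain ⟨t₁, ht₁, t₂, ht₂, hne, hf⟩ := hinf.exists_ne_map_eq_of_mapsTo hfF hF
  set χ : L ≃ₗ⁅K⁆ L := (ψ t₂).trans (ψ t₁).symm
  have hχ (x : L) : ψ t₁ (χ x) = ψ t₂ x := (ψ t₁).apply_symm_apply _
  set u : K := t₂ - t₁
  have hu : u ≠ 0 := sub_ne_zero.mpr hne.symm
  have hB (x y : L) : killingForm K L (χ x) (χ y) = killingForm K L x y :=
    LieAlgebra.killingForm_of_equiv_apply χ x y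
  have hg₁ (x y : L) : g (χ x) (χ y) = g x y + (u • killingForm K L) x y := by
    have e₁ := hψ t₁ ht₁ (χ x) (χ y)
    have e₂ := hψ t₂ ht₂ x y
    rw [hχ, hχ, hf, ← e₂] at e₁
    simp only [LinearMap.add_apply, LinearMap.smul_apply, smul_eq_mul, hB, u] at e₁ ⊢
    linear_combination e₁
  obtain ⟨D, hD⟩ := χ.exists_lieDerivation g (u • killingForm K L) hg₁ (fun x y => by
    simp only [LinearMap.smul_apply, hB])
  refine hg.isSolvable_of_killingForm_eq (u⁻¹ • D) fun x y => ?_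
  have := hD x y
  simp only [LinearMap.smul_apply, smul_eq_mul] at this
  simp only [LieDerivation.smul_apply, map_smul, LinearMap.smul_apply, smul_eq_mul]
  rw [← mul_add, ← this, inv_mul_cancel_left₀ hu]

theorem HasUniqueMetricUpToSign.isSolvable (hL : HasUniqueMetricUpToSign K L) :
    LieAlgebra.IsSolvable L := by
  obtain ⟨g, hg, h⟩ := hL
  refine hg.isSolvable_of_finite (F := {g, -g}) (Set.toFinite _) fun g' hg' => ?_
  obtain ⟨ψ, ε, rfl | rfl, hψ⟩ := h g' hg'
  · exact ⟨ψ, g, by simp, fun x y => by rw [hψ, one_mul]⟩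
  · exact ⟨ψ, -g, by simp, fun x y => by
      rw [hψ, neg_one_mul]
      rfl⟩

theorem HasUniqueMetricUpToSigns.isSolvable (hL : HasUniqueMetricUpToSigns K L) :
    LieAlgebra.IsSolvable L := by
  classical
  obtain ⟨g, n, I, hg, -, hI⟩ := hL
  let F (ε : Fin n → K) : Set (LinearMap.BilinForm K L) :=
    {h | IsOrthogonalDecomposition h I ∧ ∀ i, ∀ x ∈ I i, ∀ y ∈ I i, h x y = ε i * g x y}
  have hfin : (⋃ ε ∈ Fintype.piFinset fun _ : Fin n => ({1, -1} : Finset K), F ε).Finite := by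
    refine (Finset.finite_toSet _).biUnion fun ε _ => Set.Subsingleton.finite ?_
    rintro h ⟨hh, hhε⟩ h' ⟨hh', hhε'⟩
    exact hh.eq_of_eq_on hh' fun i x hx y hy => by rw [hhε i x hx y hy, hhε' i x hx y hy]
  refine hg.isSolvable_of_finite hfin fun g' hg' => ?_
  obtain ⟨ψ, ε, h, hε, hh, hhε, hψ⟩ := hI g' hg'
  refine ⟨ψ, h, Set.mem_biUnion ?_ ⟨hh, hhε⟩, hψ⟩
  exact Fintype.mem_piFinset.mpr fun i => by simpa using hε i

end Automorphisms

theorem mainTheorem3 {K : Type*} [RCLike K] {L : Type*} [LieRing L] [LieAlgebra K L]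
    [FiniteDimensional K L] :
    (IsCotangentSolitary K L → LieAlgebra.IsSolvable L) ∧
    (IsSolitary K L → LieAlgebra.IsSolvable L) ∧
    (HasUniqueMetricUpToSign K L → LieAlgebra.IsSolvable L) ∧
    (HasUniqueMetricUpToSigns K L → LieAlgebra.IsSolvable L) :=
  ⟨fun h => h.isSolvable, fun h => h.isSolvable, fun h => h.isSolvable, fun h => h.isSolvable⟩
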